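/- An operator space is a closed linear subspace $X$ of the bounded operators $\mathcal L(H)$ on a complex Hilbert space $H$; $M_n(X)$ carries the operator norm of $\mathcal L(\ell^2_n\otimes_2 H)$, and an operator subspace is a closed linear subspace with the inherited structure. For a linear map $T:X\to Y$ between operator spaces put $\|T\|_{cb}=\sup_n\|I_n\otimes T: M_n(X)\to M_n(Y)\|\in[0,\infty]$; $T$ is completely bounded if $\|T\|_{cb}<\infty$. Let $d_{cb}(X,Y)$ be the infimum of the $c\ge 1$ for which there is a linear bijection $e:X\to Y$ with $e,e^{-1}$ completely bounded and $\|e\|_{cb}\|e^{-1}\|_{cb}\le c$ ($\infty$ if there is none). An operator space $Z$ has the $\lambda$-CSEP if for every separable operator space $Y$, every operator subspace $X\subset Y$ and every completely bounded $T:X\to Z$ there is a completely bounded $\tilde T:Y\to Z$ extending $T$ with $\|\tilde T\|_{cb}\le\lambda\|T\|_{cb}$. A family $\mathcal Z$ of operator spaces is $C$-uniformly exact ($C\ge1$) if there is a function $\mathbf n:\mathbb N\to\mathbb N$ such that for all $k$, all $Z\in\mathcal Z$ and all $k$-dimensional subspaces $F\subset Z$ there is a linear subspace $G\subset M_{\mathbf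 n(k)}=\mathcal L(\ell^2_{\mathbf n(k)})$ with $d_{cb}(F,G)\le C$. For operator spaces $Z_j\subset\mathcal L(H_j)$, $j=1,2,\dots$, $(Z_j)_{c_0}$ is the operator space of all sequences $(z_j)$ with $z_j\in Z_j$ and $\|z_j\|\to0$, regarded as block diagonal operators on $\bigoplus_2 H_j$. Let $C\ge1$ and $\lambda\ge0$ be real. If $Z_1,Z_2,\dots$ are operator spaces that all have the $\lambda$-CSEP and $\{Z_1,Z_2,\dots\}$ is $C$-uniformly exact, then for every $\varepsilon>0$ the operator space $(Z_j)_{c_0}$ has the $(C\lambda^2+\lambda+\varepsilon)$-CSEP. -/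

import Mathlib

open scoped ENNReal NNReal
open Filter Topology

universe v u w

namespace OpSpace

/-!
An operator space is a closed linear subspace `X` of `H →L[ℂ] H` for a complex Hilbert space `H`;
it is given here as a `Submodule ℂ (H →L[ℂ] H)` together with `IsClosed (X : Set (H →L[ℂ] H))`.
An operator subspace of `X` is a closed submodule of the same `H →L[ℂ] H` that is contained in `X`.
-/

/-- The operator `(xᵢ) ↦ (∑ⱼ aᵢⱼ xⱼ)ᵢ` on the Hilbert space `ℓ²ₙ ⊗ H = H ⊕₂ ⋯ ⊕₂ H` given by a
matrix `(aᵢⱼ)` of bounded operators on `H`. -/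
noncomputable def blockOp {H : Type*} [NormedAddCommGroup H] [InnerProductSpace ℂ H] {n : ℕ}
    (A : Matrix (Fin n) (Fin n) (H →L[ℂ] H)) :
    PiLp 2 (fun _ : Fin n => H) →L[ℂ] PiLp 2 (fun _ : Fin n => H) :=
  ((PiLp.continuousLinearEquiv 2 ℂ (fun _ : Fin n => H)).symm :
      (Fin n → H) →L[ℂ] PiLp 2 (fun _ : Fin n => H)) ∘L
    ContinuousLinearMap.pi (fun i => ∑ j, (A i j) ∘L PiLp.proj 2 (fun _ : Fin n => H) j)

/-- The norm of `Mₙ(X)`, for `X` a subspace of the bounded operators on `H`: the operator norm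
on `ℓ²ₙ ⊗ H`. -/
noncomputable def matNorm {H : Type*} [NormedAddCommGroup H] [InnerProductSpace ℂ H]
    {X : Submodule ℂ (H →L[ℂ] H)} {n : ℕ} (A : Matrix (Fin n) (Fin n) X) : ℝ≥0∞ :=
  ‖blockOp (A.map (fun a => (a : H →L[ℂ] H)))‖ₑ

/-- `‖T‖ₙ = ‖Iₙ ⊗ T : Mₙ(X) → Mₙ(Y)‖`, with the value `∞` allowed. -/
noncomputable def ampNorm {H K : Type*} [NormedAddCommGroup H] [InnerProductSpace ℂ H]
    [NormedAddCommGroup K] [InnerProductSpace ℂ K]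
    {X : Submodule ℂ (H →L[ℂ] H)} {Y : Submodule ℂ (K →L[ℂ] K)}
    (n : ℕ) (T : X →ₗ[ℂ] Y) : ℝ≥0∞ :=
  ⨆ (A : Matrix (Fin n) (Fin n) X) (_ : matNorm A ≤ 1), matNorm (A.map T)

/-- `‖T‖_cb = supₙ ‖T‖ₙ`, with the value `∞` allowed. -/
noncomputable def cbNorm {H K : Type*} [NormedAddCommGroup H] [InnerProductSpace ℂ H]
    [NormedAddCommGroup K] [InnerProductSpace ℂ K]
    {X : Submodule ℂ (H →L[ℂ] H)} {Y : Submodule ℂ (K →L[ℂ] K)}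
    (T : X →ₗ[ℂ] Y) : ℝ≥0∞ :=
  ⨆ n : ℕ, ampNorm n T

/-- `T` is completely bounded. -/
def CompletelyBounded {H K : Type*} [NormedAddCommGroup H] [InnerProductSpace ℂ H]
    [NormedAddCommGroup K] [InnerProductSpace ℂ K]
    {X : Submodule ℂ (H →L[ℂ] H)} {Y : Submodule ℂ (K →L[ℂ] K)}
    (T : X →ₗ[ℂ] Y) : Prop :=
  cbNorm T < ∞

/-- `X` and `Y` are `c`-completely isomorphic. -/
def CompletelyIsomorphic {H K : Type*} [NormedAddCommGroup H] [InnerProductSpace ℂ H]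
    [NormedAddCommGroup K] [InnerProductSpace ℂ K]
    (c : ℝ≥0∞) (X : Submodule ℂ (H →L[ℂ] H)) (Y : Submodule ℂ (K →L[ℂ] K)) : Prop :=
  ∃ e : X ≃ₗ[ℂ] Y, CompletelyBounded e.toLinearMap ∧ CompletelyBounded e.symm.toLinearMap ∧
    cbNorm e.toLinearMap * cbNorm e.symm.toLinearMap ≤ c

/-- The completely bounded distance `d_cb(X, Y)`; it is `∞` if `X` and `Y` are not completely
isomorphic. -/
noncomputable def cbDist {H K : Type*} [NormedAddCommGroup H] [InnerProductSpace ℂ H]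
    [NormedAddCommGroup K] [InnerProductSpace ℂ K]
    (X : Submodule ℂ (H →L[ℂ] H)) (Y : Submodule ℂ (K →L[ℂ] K)) : ℝ≥0∞ :=
  sInf {c : ℝ≥0∞ | 1 ≤ c ∧ CompletelyIsomorphic c X Y}

/-- The family `Z` is `C`-uniformly exact: for some function `N`, every `k`-dimensional subspace of
every member is at cb-distance at most `C` from a subspace of the operator space `M_{N(k)}` of all
operators on the Hilbert space `ℂ^{N(k)}`. -/
def UniformlyExact (C : ℝ≥0) {ι : Type w} {H : ι → Type u}
    [∀ j, NormedAddCommGroup (H j)] [∀ j, InnerProductSpace ℂ (H j)]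
    (Z : ∀ j, Submodule ℂ (H j →L[ℂ] H j)) : Prop :=
  1 ≤ C ∧ ∃ N : ℕ → ℕ, ∀ (j : ι) (k : ℕ) (F : Submodule ℂ (H j →L[ℂ] H j)),
    F ≤ Z j → FiniteDimensional ℂ F → Module.finrank ℂ F = k →
      ∃ G : Submodule ℂ
          (EuclideanSpace ℂ (Fin (N k)) →L[ℂ] EuclideanSpace ℂ (Fin (N k))),
        cbDist F G ≤ C

/-- The `c`-Complete Separable Extension Property of `Z`: every completely bounded `T : X → Z`
on a subspace `X` of a separable operator space `Y` has an extension to `Y` of cb-norm at most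
`c ‖T‖_cb`. -/
def HasCSEP (c : ℝ≥0) {H : Type u} [NormedAddCommGroup H] [InnerProductSpace ℂ H]
    (Z : Submodule ℂ (H →L[ℂ] H)) : Prop :=
  ∀ (K : Type v) [NormedAddCommGroup K] [InnerProductSpace ℂ K] [CompleteSpace K]
    (X Y : Submodule ℂ (K →L[ℂ] K)) (hXY : X ≤ Y),
    IsClosed (X : Set (K →L[ℂ] K)) → IsClosed (Y : Set (K →L[ℂ] K)) →
    TopologicalSpace.SeparableSpace Y →
    ∀ T : X →ₗ[ℂ] Z, CompletelyBounded T →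
      ∃ T' : Y →ₗ[ℂ] Z, CompletelyBounded T' ∧
        (∀ x : X, T' (Submodule.inclusion hXY x) = T x) ∧ cbNorm T' ≤ c * cbNorm T

/-- The `c₀`-sum of a sequence of operator spaces `Zⱼ` on `Hⱼ`, realized on the Hilbert space
direct sum of the `Hⱼ` as the block diagonal operators `z₀ ⊕ z₁ ⊕ ⋯` with `zⱼ ∈ Zⱼ` and
`‖zⱼ‖ → 0`. -/
def c0Sum {H : ℕ → Type*} [∀ j, NormedAddCommGroup (H j)] [∀ j, InnerProductSpace ℂ (H j)]
    (Z : ∀ j, Submodule ℂ (H j →L[ℂ] H j)) :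
    Submodule ℂ (lp H 2 →L[ℂ] lp H 2) where
  carrier := {S | ∃ z : ∀ j, H j →L[ℂ] H j, (∀ j, z j ∈ Z j) ∧
    Tendsto (fun j => ‖z j‖) atTop (𝓝 0) ∧ ∀ (x : lp H 2) (j : ℕ), S x j = z j (x j)}
  zero_mem' := ⟨fun _ => 0, fun j => (Z j).zero_mem, by simp, fun x j => by simp⟩
  add_mem' := by
    rintro S S' ⟨z, hz, hz0, hS⟩ ⟨z', hz', hz0', hS'⟩
    refine ⟨fun j => z j + z' j, fun j => (Z j).add_mem (hz j) (hz' j), ?_, fun x j => ?_⟩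
    · refine squeeze_zero (fun j => norm_nonneg _) (fun j => norm_add_le _ _) ?_
      simpa using hz0.add hz0'
    · simp [hS, hS']
  smul_mem' := by
    rintro a S ⟨z, hz, hz0, hS⟩
    refine ⟨fun j => a • z j, fun j => (Z j).smul_mem a (hz j), ?_, fun x j => ?_⟩
    · simpa [norm_smul] using hz0.const_mul ‖a‖
    · simp [hS]

end OpSpace

/-! Each coordinate of T : X → c₀-sum extends to E_j : Y → Z_j with cb-norm at most λ‖T‖_cb. The E_j
are pointwise null on X but need not be on Y, so they do not yet define a map into the c₀-sum. One
subtracts S_j : Y → Z_j vanishing on X with E_j - S_j pointwise null on Y; `exists_toC0Sum` then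
assembles the extension.

To make S_j close to E_j on a finite set s, let P be a finite rank projection of V = span s + X with
kernel X. The map w = E_j ∘ P kills X and is close to E_j on s for large j, because y - P y lies in
X. The CSEP of Z_j extends w from V to Y at the cost of a second factor λ.

The cb-norm of P is not controlled, so ‖w‖_cb must be bounded differently. The rank of w is at most
that of P, so uniform exactness places its range within cb-distance C of a subspace of some M_m,
with m bounded independently of j. By Smith's lemma (`cbNorm_le_ampNorm`), ‖w‖_cb is then at most
about C‖w‖_n for one fixed n. At that fixed level a compactness argument
(`eventually_ampNorm_comp_le`) gives ‖w‖_n ≤ λ‖T‖_cb + δ for large j. Hence ‖S_j‖_cb is at most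
about Cλ²‖T‖_cb, and E_j contributes the remaining λ‖T‖_cb. -/

namespace OpSpace

/-! ### Norms of block operators -/

section BlockOp

variable {H : Type*} [NormedAddCommGroup H] [InnerProductSpace ℂ H] {n : ℕ}

lemma blockOp_apply (A : Matrix (Fin n) (Fin n) (H →L[ℂ] H)) (x : PiLp 2 (fun _ : Fin n => H))
    (i : Fin n) : blockOp A x i = ∑ j, A i j (x j) := by
  simp [blockOp]

lemma norm_blockOp_le_iff {A : Matrix (Fin n) (Fin n) (H →L[ℂ] H)} {c : ℝ} (hc : 0 ≤ c) :
    ‖blockOp A‖ ≤ c ↔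
      ∀ x : Fin n → H, ∑ i, ‖∑ j, A i j (x j)‖ ^ 2 ≤ c ^ 2 * ∑ j, ‖x j‖ ^ 2 := by
  have key : ∀ x : PiLp 2 (fun _ : Fin n => H), ‖blockOp A x‖ ≤ c * ‖x‖ ↔
      ∑ i, ‖∑ j, A i j (x j)‖ ^ 2 ≤ c ^ 2 * ∑ j, ‖x j‖ ^ 2 := fun x => by
    rw [← sq_le_sq₀ (norm_nonneg _) (by positivity), mul_pow, PiLp.norm_sq_eq_of_L2,
      PiLp.norm_sq_eq_of_L2]
    simp only [blockOp_apply]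
  rw [ContinuousLinearMap.opNorm_le_iff hc]
  exact ⟨fun h x => (key (WithLp.toLp 2 x)).1 (h _), fun h x => (key x).2 (h _)⟩

lemma sum_norm_sq_le_norm_blockOp (A : Matrix (Fin n) (Fin n) (H →L[ℂ] H)) (x : Fin n → H) :
    ∑ i, ‖∑ j, A i j (x j)‖ ^ 2 ≤ ‖blockOp A‖ ^ 2 * ∑ j, ‖x j‖ ^ 2 :=
  (norm_blockOp_le_iff (ContinuousLinearMap.opNorm_nonneg _)).1 le_rfl x

lemma norm_entry_le_norm_blockOp (A : Matrix (Fin n) (Fin n) (H →L[ℂ] H)) (i j : Fin n) :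
    ‖A i j‖ ≤ ‖blockOp A‖ := by
  have h0 : 0 ≤ ‖blockOp A‖ := ContinuousLinearMap.opNorm_nonneg _
  refine ContinuousLinearMap.opNorm_le_bound _ h0 fun h => ?_
  rw [← sq_le_sq₀ (norm_nonneg _) (mul_nonneg h0 (norm_nonneg _)), mul_pow]
  have := sum_norm_sq_le_norm_blockOp A (Pi.single j h)
  have h1 : ∀ i, ∑ k, A i k ((Pi.single j h : Fin n → H) k) = A i j h := fun i => by
    rw [Finset.sum_eq_single j] <;> simp +contextual
  have h2 : ∑ k, ‖(Pi.single j h : Fin n → H) k‖ ^ 2 = ‖h‖ ^ 2 := by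
    rw [Finset.sum_eq_single j] <;> simp +contextual
  simp only [h1, h2] at this
  exact (Finset.single_le_sum (f := fun i => ‖A i j h‖ ^ 2) (fun i _ => by positivity)
    (Finset.mem_univ i)).trans this

lemma blockOp_add (A B : Matrix (Fin n) (Fin n) (H →L[ℂ] H)) :
    blockOp (A + B) = blockOp A + blockOp B := by
  ext x i
  simp [blockOp_apply, Finset.sum_add_distrib]

lemma blockOp_smul (c : ℂ) (A : Matrix (Fin n) (Fin n) (H →L[ℂ] H)) :
    blockOp (c • A) = c • blockOp A := by
  ext x i
  simp [blockOp_apply, Finset.smul_sum]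

/-- Cauchy–Schwarz in each row. The factor n is harmless in the application, where n is fixed before
the entrywise accuracy is chosen. -/
lemma norm_blockOp_le_of_entry_le {A : Matrix (Fin n) (Fin n) (H →L[ℂ] H)} {c : ℝ} (hc : 0 ≤ c)
    (hA : ∀ i j, ‖A i j‖ ≤ c) : ‖blockOp A‖ ≤ n * c := by
  rw [norm_blockOp_le_iff (by positivity)]
  intro x
  have h1 : ∀ i, ‖∑ j, A i j (x j)‖ ^ 2 ≤ n * c ^ 2 * ∑ j, ‖x j‖ ^ 2 := fun i => by
    have h2 : ‖∑ j, A i j (x j)‖ ≤ c * ∑ j, ‖x j‖ := by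
      rw [Finset.mul_sum]
      exact (norm_sum_le _ _).trans (Finset.sum_le_sum fun j _ =>
        ((A i j).le_opNorm _).trans (mul_le_mul_of_nonneg_right (hA i j) (norm_nonneg _)))
    have h3 : (∑ j, ‖x j‖) ^ 2 ≤ n * ∑ j, ‖x j‖ ^ 2 := by
      simpa using sq_sum_le_card_mul_sum_sq (s := Finset.univ) (f := fun j => ‖x j‖)
    calc _ ≤ (c * ∑ j, ‖x j‖) ^ 2 := by gcongr
      _ = c ^ 2 * (∑ j, ‖x j‖) ^ 2 := by ring
      _ ≤ c ^ 2 * (n * ∑ j, ‖x j‖ ^ 2) := by gcongr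
      _ = _ := by ring
  calc _ ≤ ∑ i : Fin n, n * c ^ 2 * ∑ j, ‖x j‖ ^ 2 := Finset.sum_le_sum fun i _ => h1 i
    _ = _ := by simp; ring

end BlockOp

lemma opNorm_smul_eq {E F : Type*} [SeminormedAddCommGroup E] [NormedSpace ℂ E]
    [SeminormedAddCommGroup F] [NormedSpace ℂ F] (c : ℂ) (T : E →L[ℂ] F) :
    ‖c • T‖ = ‖c‖ * ‖T‖ :=
  norm_smul c T

/-! ### Matrix norms, amplifications and cb-norms -/

section MatNorm

variable {H K L : Type*} [NormedAddCommGroup H] [InnerProductSpace ℂ H]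
  [NormedAddCommGroup K] [InnerProductSpace ℂ K] [NormedAddCommGroup L] [InnerProductSpace ℂ L]
  {X : Submodule ℂ (H →L[ℂ] H)} {Y : Submodule ℂ (K →L[ℂ] K)} {W : Submodule ℂ (L →L[ℂ] L)} {n : ℕ}

lemma matNorm_eq_ofReal (A : Matrix (Fin n) (Fin n) X) :
    matNorm A = ENNReal.ofReal ‖blockOp (Matrix.of fun i j => (A i j : H →L[ℂ] H))‖ :=
  (ofReal_norm (E := PiLp 2 (fun _ : Fin n => H) →L[ℂ] PiLp 2 (fun _ : Fin n => H)) _).symm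

lemma matNorm_ne_top (A : Matrix (Fin n) (Fin n) X) : matNorm A ≠ ∞ := by
  rw [matNorm_eq_ofReal]
  exact ENNReal.ofReal_ne_top

lemma matNorm_le_coe_iff {A : Matrix (Fin n) (Fin n) X} {c : ℝ≥0} :
    matNorm A ≤ c ↔ ∀ x : Fin n → H,
      ∑ i, ‖∑ j, (A i j : H →L[ℂ] H) (x j)‖ ^ 2 ≤ (c : ℝ) ^ 2 * ∑ j, ‖x j‖ ^ 2 := by
  rw [matNorm_eq_ofReal, ← ENNReal.ofReal_coe_nnreal]
  exact (ENNReal.ofReal_le_ofReal_iff c.2).trans (norm_blockOp_le_iff c.2)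

lemma matNorm_congr {X' : Submodule ℂ (H →L[ℂ] H)} {A : Matrix (Fin n) (Fin n) X}
    {B : Matrix (Fin n) (Fin n) X'} (h : ∀ i j, (A i j : H →L[ℂ] H) = B i j) :
    matNorm A = matNorm B := by
  rw [matNorm_eq_ofReal, matNorm_eq_ofReal]
  simp only [h]

lemma enorm_entry_le_matNorm (A : Matrix (Fin n) (Fin n) X) (i j : Fin n) :
    ‖A i j‖ₑ ≤ matNorm A := by
  rw [matNorm_eq_ofReal, ← ofReal_norm]
  exact ENNReal.ofReal_le_ofReal
    (norm_entry_le_norm_blockOp (Matrix.of fun i j => (A i j : H →L[ℂ] H)) i j)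

lemma matNorm_le_of_entry_le {A : Matrix (Fin n) (Fin n) X} {c : ℝ≥0}
    (hA : ∀ i j, ‖A i j‖ ≤ c) : matNorm A ≤ (n * c : ℝ≥0) := by
  rw [matNorm_eq_ofReal, ← ENNReal.ofReal_coe_nnreal]
  refine ENNReal.ofReal_le_ofReal ?_
  simpa using norm_blockOp_le_of_entry_le
    (A := Matrix.of fun i j => (A i j : H →L[ℂ] H)) c.2 hA

lemma matNorm_add_le (A B : Matrix (Fin n) (Fin n) X) :
    matNorm (A + B) ≤ matNorm A + matNorm B := by
  simp only [matNorm_eq_ofReal]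
  rw [← ENNReal.ofReal_add (ContinuousLinearMap.opNorm_nonneg _)
    (ContinuousLinearMap.opNorm_nonneg _)]
  refine ENNReal.ofReal_le_ofReal (le_trans (le_of_eq ?_) (ContinuousLinearMap.opNorm_add_le _ _))
  rw [← blockOp_add]
  rfl

lemma matNorm_smul (c : ℂ) (A : Matrix (Fin n) (Fin n) X) :
    matNorm (c • A) = ‖c‖ₑ * matNorm A := by
  have h : ‖c • blockOp (Matrix.of fun i j => (A i j : H →L[ℂ] H))‖
      = ‖c‖ * ‖blockOp (Matrix.of fun i j => (A i j : H →L[ℂ] H))‖ :=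
    opNorm_smul_eq c _
  rw [matNorm_eq_ofReal, matNorm_eq_ofReal, ← ofReal_norm, ← ENNReal.ofReal_mul (norm_nonneg _),
    ← h, ← blockOp_smul]
  rfl

lemma matNorm_neg (A : Matrix (Fin n) (Fin n) X) : matNorm (-A) = matNorm A := by
  have := matNorm_smul (-1) A
  rw [enorm_neg, enorm_one, one_mul] at this
  rw [← this]
  exact matNorm_congr fun i j => by simp

lemma matNorm_eq_zero {A : Matrix (Fin n) (Fin n) X} (h : matNorm A = 0) : A = 0 := by
  ext i j : 2
  simpa [h] using enorm_entry_le_matNorm A i j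

lemma matNorm_zero : matNorm (0 : Matrix (Fin n) (Fin n) X) = 0 := by
  simpa using matNorm_smul 0 (0 : Matrix (Fin n) (Fin n) X)

lemma enorm_le_matNorm_one (x : X) : matNorm (fun _ _ : Fin 1 => x) = ‖x‖ₑ := by
  refine le_antisymm ?_ (enorm_entry_le_matNorm (fun _ _ : Fin 1 => x) 0 0)
  refine (matNorm_le_of_entry_le (A := fun _ _ : Fin 1 => x) (c := ‖x‖₊)
    fun _ _ => le_rfl).trans ?_
  rw [Nat.cast_one, one_mul]
  exact le_rfl

lemma matNorm_map_le_ampNorm (T : X →ₗ[ℂ] Y) (A : Matrix (Fin n) (Fin n) X) :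
    matNorm (A.map T) ≤ ampNorm n T * matNorm A := by
  rcases eq_or_ne (matNorm A) 0 with h | h
  · rw [matNorm_eq_zero h]
    have : (0 : Matrix (Fin n) (Fin n) X).map T = 0 := by ext; simp
    simp [this, matNorm_zero]
  set r : ℝ := (matNorm A).toReal with hr
  have hr0 : 0 < r := ENNReal.toReal_pos h (matNorm_ne_top A)
  have hrA : matNorm A = ENNReal.ofReal r := (ENNReal.ofReal_toReal (matNorm_ne_top A)).symm
  have hc : ‖((r⁻¹ : ℝ) : ℂ)‖ₑ = (ENNReal.ofReal r)⁻¹ := by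
    rw [← ENNReal.ofReal_inv_of_pos hr0, ← ofReal_norm]
    simp [abs_of_pos hr0]
  have h1 : matNorm (((r⁻¹ : ℝ) : ℂ) • A) ≤ 1 := by
    rw [matNorm_smul, hc, hrA]
    exact ENNReal.inv_mul_le_one _
  have h2 := le_iSup₂ (f := fun (A : Matrix (Fin n) (Fin n) X) (_ : matNorm A ≤ 1) =>
    matNorm (A.map T)) _ h1
  have h3 : (((r⁻¹ : ℝ) : ℂ) • A).map T = ((r⁻¹ : ℝ) : ℂ) • A.map T := by ext; simp
  simp only [h3, matNorm_smul, hc] at h2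
  rw [← hrA] at h2
  calc matNorm (A.map T) = (matNorm A)⁻¹ * matNorm (A.map T) * matNorm A := by
        rw [mul_comm, ← mul_assoc, ENNReal.mul_inv_cancel h (matNorm_ne_top A), one_mul]
    _ ≤ _ := by gcongr; exact h2

lemma ampNorm_le {T : X →ₗ[ℂ] Y} {c : ℝ≥0∞}
    (h : ∀ A : Matrix (Fin n) (Fin n) X, matNorm (A.map T) ≤ c * matNorm A) : ampNorm n T ≤ c :=
  iSup₂_le fun A hA => (h A).trans (mul_le_of_le_one_right' hA)

lemma ampNorm_le_cbNorm (n : ℕ) (T : X →ₗ[ℂ] Y) : ampNorm n T ≤ cbNorm T :=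
  le_iSup (fun n => ampNorm n T) n

lemma matNorm_map_le_cbNorm (T : X →ₗ[ℂ] Y) (A : Matrix (Fin n) (Fin n) X) :
    matNorm (A.map T) ≤ cbNorm T * matNorm A :=
  (matNorm_map_le_ampNorm T A).trans (by gcongr; exact ampNorm_le_cbNorm n T)

lemma cbNorm_le {T : X →ₗ[ℂ] Y} {c : ℝ≥0∞}
    (h : ∀ (n : ℕ) (A : Matrix (Fin n) (Fin n) X), matNorm (A.map T) ≤ c * matNorm A) :
    cbNorm T ≤ c :=
  iSup_le fun n => ampNorm_le (h n)

lemma enorm_le_cbNorm_mul (T : X →ₗ[ℂ] Y) (x : X) : ‖T x‖ₑ ≤ cbNorm T * ‖x‖ₑ := by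
  have := matNorm_map_le_cbNorm T (fun _ _ : Fin 1 => x)
  rw [enorm_le_matNorm_one] at this
  exact (enorm_le_matNorm_one (T x)).symm.le.trans this

lemma cbNorm_comp_le (S : Y →ₗ[ℂ] W) (T : X →ₗ[ℂ] Y) :
    cbNorm (S ∘ₗ T) ≤ cbNorm S * cbNorm T :=
  cbNorm_le fun n A => calc
    matNorm (A.map (S ∘ₗ T)) = matNorm ((A.map T).map S) := rfl
    _ ≤ cbNorm S * (cbNorm T * matNorm A) :=
      (matNorm_map_le_cbNorm S _).trans (by gcongr; exact matNorm_map_le_cbNorm T A)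
    _ = _ := (mul_assoc _ _ _).symm

/-- The inner factor stays at level n, so a bound on one amplification survives composition with a
complete isomorphism. -/
lemma ampNorm_comp_le (S : Y →ₗ[ℂ] W) (T : X →ₗ[ℂ] Y) :
    ampNorm n (S ∘ₗ T) ≤ cbNorm S * ampNorm n T :=
  ampNorm_le fun A => calc
    matNorm (A.map (S ∘ₗ T)) = matNorm ((A.map T).map S) := rfl
    _ ≤ cbNorm S * (ampNorm n T * matNorm A) :=
      (matNorm_map_le_cbNorm S _).trans (by gcongr; exact matNorm_map_le_ampNorm T A)
    _ = _ := (mul_assoc _ _ _).symm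

lemma cbNorm_sub_le (S T : X →ₗ[ℂ] Y) : cbNorm (S - T) ≤ cbNorm S + cbNorm T := by
  refine cbNorm_le fun n A => ?_
  have h : A.map ⇑(S - T : X →ₗ[ℂ] Y) =
      (A.map S : Matrix (Fin n) (Fin n) Y) + -(A.map T : Matrix (Fin n) (Fin n) Y) := by
    ext i j : 2
    simp only [Matrix.map_apply, Matrix.add_apply, Matrix.neg_apply, LinearMap.sub_apply,
      sub_eq_add_neg]
  rw [h, add_mul]
  refine (matNorm_add_le _ _).trans ?_
  rw [matNorm_neg]
  exact add_le_add (matNorm_map_le_cbNorm _ A) (matNorm_map_le_cbNorm _ A)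

/-- Linear maps with the same underlying values have the same cb-norm. -/
lemma cbNorm_congr {Y' : Submodule ℂ (K →L[ℂ] K)} {S : X →ₗ[ℂ] Y} {T : X →ₗ[ℂ] Y'}
    (h : ∀ x, (S x : K →L[ℂ] K) = T x) : cbNorm S = cbNorm T := by
  refine le_antisymm (cbNorm_le fun n A => ?_) (cbNorm_le fun n A => ?_)
  · rw [matNorm_congr (A := A.map S) (B := A.map T) fun i j => h _]
    exact matNorm_map_le_cbNorm _ _
  · rw [matNorm_congr (A := A.map T) (B := A.map S) fun i j => (h _).symm]
    exact matNorm_map_le_cbNorm _ _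

lemma ampNorm_congr {Y' : Submodule ℂ (K →L[ℂ] K)} {S : X →ₗ[ℂ] Y} {T : X →ₗ[ℂ] Y'}
    (h : ∀ x, (S x : K →L[ℂ] K) = T x) : ampNorm n S = ampNorm n T := by
  refine le_antisymm (ampNorm_le fun A => ?_) (ampNorm_le fun A => ?_)
  · rw [matNorm_congr (A := A.map S) (B := A.map T) fun i j => h _]
    exact matNorm_map_le_ampNorm _ _
  · rw [matNorm_congr (A := A.map T) (B := A.map S) fun i j => (h _).symm]
    exact matNorm_map_le_ampNorm _ _

end MatNorm

/-! ### Smith's lemma -/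

section Smith

/-- A scalar matrix acting on column vectors with entries in `E`. -/
def colAct {E : Type*} [NormedAddCommGroup E] [InnerProductSpace ℂ E] {r n : ℕ}
    (a : Matrix (Fin r) (Fin n) ℂ) (x : Fin n → E) : Fin r → E :=
  fun j => ∑ k, a j k • x k

section ColAct

variable {E F : Type*} [NormedAddCommGroup E] [InnerProductSpace ℂ E]
  [NormedAddCommGroup F] [InnerProductSpace ℂ F] {r n s : ℕ}

lemma colAct_mul (a : Matrix (Fin r) (Fin n) ℂ) (b : Matrix (Fin n) (Fin s) ℂ) (x : Fin s → E) :
    colAct (a * b) x = colAct a (colAct b x) := by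
  ext j
  simp only [colAct, Matrix.mul_apply, Finset.sum_smul, Finset.smul_sum, mul_smul]
  exact Finset.sum_comm

lemma sum_inner_colAct (a : Matrix (Fin r) (Fin n) ℂ) (x : Fin n → E) (y : Fin r → E) :
    ∑ j, inner ℂ (colAct a x j) (y j) = ∑ k, inner ℂ (x k) (colAct a.conjTranspose y k) := by
  simp only [colAct, sum_inner, inner_sum, inner_smul_left, inner_smul_right,
    Matrix.conjTranspose_apply]
  exact Finset.sum_comm

/-- Partial isometries are contractions. -/
lemma sum_norm_sq_colAct_le {a : Matrix (Fin r) (Fin n) ℂ} (ha : a * a.conjTranspose * a = a)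
    (x : Fin n → E) : ∑ j, ‖colAct a x j‖ ^ 2 ≤ ∑ k, ‖x k‖ ^ 2 := by
  -- With y = ax and w = a*ax one has ‖y‖² = Re⟨x, w⟩ = ‖w‖², and expanding ‖x - w‖² ≥ 0 gives the
  -- claim.
  set y := colAct a x with hy
  set w := colAct a.conjTranspose y with hw
  have haw : colAct a w = y := by
    rw [hw, hy, ← colAct_mul, ← colAct_mul, ha]
  have h1 : ∑ j, ‖y j‖ ^ 2 = RCLike.re (∑ k, inner ℂ (x k) (w k)) := by
    rw [← sum_inner_colAct, map_sum]
    exact Finset.sum_congr rfl fun j _ => (inner_self_eq_norm_sq (𝕜 := ℂ) _).symm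
  have h2 : ∑ j, ‖y j‖ ^ 2 = ∑ k, ‖w k‖ ^ 2 := by
    have h := sum_inner_colAct a w y
    rw [haw] at h
    have h' := congrArg RCLike.re h
    rw [map_sum, map_sum] at h'
    simpa only [← hw, inner_self_eq_norm_sq] using h'
  have h3 : ∑ k, ‖x k - w k‖ ^ 2
      = ∑ k, ‖x k‖ ^ 2 - 2 * RCLike.re (∑ k, inner ℂ (x k) (w k)) + ∑ k, ‖w k‖ ^ 2 := by
    rw [map_sum, Finset.mul_sum, ← Finset.sum_sub_distrib, ← Finset.sum_add_distrib]
    exact Finset.sum_congr rfl fun k _ => norm_sub_sq (𝕜 := ℂ) _ _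
  have h4 : 0 ≤ ∑ k, ‖x k - w k‖ ^ 2 := by positivity
  linarith

/-- Associativity (bMa)x = b(M(ax)) for scalar a and b; it transfers norm bounds from M to its
compression. -/
lemma colAct_compress (b : Matrix (Fin s) (Fin r) ℂ) (a : Matrix (Fin r) (Fin n) ℂ)
    (M : Fin r → Fin r → E →L[ℂ] E) (x : Fin n → E) (l : Fin s) :
    ∑ k, (∑ i, ∑ j, (b l i * a j k) • M i j) (x k)
      = colAct b (fun i => ∑ j, M i j (colAct a x j)) l := by
  simp only [colAct, _root_.sum_apply, _root_.smul_apply, map_sum, map_smul,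
    Finset.smul_sum, smul_smul]
  rw [Finset.sum_comm]
  refine Finset.sum_congr rfl fun i _ => ?_
  rw [Finset.sum_comm]

end ColAct

/-- Vectors `ξ₁, …, ξᵣ` in `ℂᵐ` are fixed by the range projection of a partial isometry
`ℂⁿ → ℂʳ`, as soon as `m ≤ n`. -/
lemma exists_partialIsometry {m n r : ℕ} (hmn : m ≤ n)
    (ξ : Fin r → EuclideanSpace ℂ (Fin m)) :
    ∃ a : Matrix (Fin r) (Fin n) ℂ, a * a.conjTranspose * a = a ∧
      colAct (a * a.conjTranspose) ξ = ξ := by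
  -- The m coordinates of the ξ_j give m columns in ℂʳ, whose span W has dimension at most m ≤ n.
  -- The columns of a are an orthonormal basis of W padded by zeros, so a a* is the projection onto
  -- W.
  let col : Fin m → EuclideanSpace ℂ (Fin r) := fun p => WithLp.toLp 2 fun j => ξ j p
  set W : Submodule ℂ (EuclideanSpace ℂ (Fin r)) := Submodule.span ℂ (Set.range col) with hW
  have hd : Module.finrank ℂ W ≤ n :=
    ((finrank_range_le_card col).trans (by simp)).trans hmn
  let b := stdOrthonormalBasis ℂ W
  let a : Matrix (Fin r) (Fin n) ℂ := fun j k =>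
    if h : (k : ℕ) < Module.finrank ℂ W then (b ⟨k, h⟩ : EuclideanSpace ℂ (Fin r)) j else 0
  have hmem : ∀ k, WithLp.toLp 2 (fun j => a j k) ∈ W := fun k => by
    by_cases h : (k : ℕ) < Module.finrank ℂ W
    · simp only [a, h, dif_pos]
      exact (b ⟨k, h⟩).2
    · simp only [a, h, dif_neg, not_false_eq_true]
      exact W.zero_mem
  have hfix : ∀ v ∈ W, ∀ j, ∑ i, (a * a.conjTranspose) j i * v i = v j := fun v hv j => by
    have h1 := congrArg (fun w : W => (w : EuclideanSpace ℂ (Fin r)) j) (b.sum_repr' ⟨v, hv⟩)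
    simp only [AddSubmonoidClass.coe_finsetSum, SetLike.val_smul] at h1
    rw [WithLp.ofLp_sum, Finset.sum_apply] at h1
    rw [← h1]
    have h2 : ∑ i, (a * a.conjTranspose) j i * v i
        = ∑ k : Fin n, (∑ i, star (a i k) * v i) * a j k := by
      simp only [Matrix.mul_apply, Matrix.conjTranspose_apply, Finset.sum_mul]
      rw [Finset.sum_comm]
      exact Finset.sum_congr rfl fun k _ => Finset.sum_congr rfl fun i _ => by ring
    rw [h2]
    symm
    refine Finset.sum_of_injOn (Fin.castLE hd) (Fin.castLE_injective hd).injOn (by simp) ?_ ?_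
    · intro k _ hk
      have : ¬ (k : ℕ) < Module.finrank ℂ W := fun h => hk ⟨⟨k, h⟩, by simp, by ext; simp⟩
      simp [a, this]
    · intro k _
      simp [a, EuclideanSpace.inner_eq_star_dotProduct, dotProduct, mul_comm]
  refine ⟨a, ?_, ?_⟩
  · ext j k
    rw [Matrix.mul_apply]
    exact hfix _ (hmem k) j
  · ext j p
    have := hfix (col p) (Submodule.subset_span ⟨p, rfl⟩) j
    simpa [colAct, col] using this

variable {K : Type*} [NormedAddCommGroup K] [InnerProductSpace ℂ K]

/-- Smith's lemma: the cb-norm of a map into a subspace of `Mₘ` is attained at every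
amplification of order at least `m`. -/
lemma cbNorm_le_ampNorm {m n : ℕ} (hmn : m ≤ n) {V : Submodule ℂ (K →L[ℂ] K)}
    {G : Submodule ℂ (EuclideanSpace ℂ (Fin m) →L[ℂ] EuclideanSpace ℂ (Fin m))}
    (u : V →ₗ[ℂ] G) : cbNorm u ≤ ampNorm n u := by
  refine cbNorm_le fun r A => ?_
  rcases eq_or_ne (ampNorm n u) ∞ with htop | htop
  · rcases eq_or_ne (matNorm A) 0 with h | h
    · rw [matNorm_eq_zero h]
      have : (0 : Matrix (Fin r) (Fin r) V).map u = 0 := by ext; simp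
      simp [this, matNorm_zero]
    · simp [htop, h]
  lift ampNorm n u to ℝ≥0 using htop with c hc
  obtain ⟨N, hN⟩ : ∃ N : ℝ≥0, matNorm A = N := ⟨_, (ENNReal.coe_toNNReal (matNorm_ne_top A)).symm⟩
  rw [hN, ← ENNReal.coe_mul, matNorm_le_coe_iff]
  intro ξ
  set η : Fin r → EuclideanSpace ℂ (Fin m) :=
    fun i => ∑ j, ((A.map u) i j : EuclideanSpace ℂ (Fin m) →L[ℂ] _) (ξ j) with hη
  obtain ⟨a, ha, haξ⟩ := exists_partialIsometry hmn ξ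
  obtain ⟨b, hb, hbη⟩ := exists_partialIsometry hmn η
  have hstar : ∀ {a : Matrix (Fin r) (Fin n) ℂ}, a * a.conjTranspose * a = a →
      a.conjTranspose * a.conjTranspose.conjTranspose * a.conjTranspose = a.conjTranspose :=
    fun {a} h => by
      have := congrArg Matrix.conjTranspose h
      simpa [Matrix.conjTranspose_mul, Matrix.mul_assoc] using this
  -- B = b* A a is an n × n compression of A with norm at most that of A. Since a a* fixes ξ and b
  -- b* fixes η = u(A)ξ, the vector η is recovered as b u(B) a* ξ.
  let B : Matrix (Fin n) (Fin n) V := fun l k => ∑ i, ∑ j, (b.conjTranspose l i * a j k) • A i j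
  have hB : matNorm B ≤ N := by
    rw [matNorm_le_coe_iff]
    intro x
    have h1 : (fun l => ∑ k, (B l k : K →L[ℂ] K) (x k))
        = colAct b.conjTranspose (fun i => ∑ j, (A i j : K →L[ℂ] K) (colAct a x j)) := by
      ext l
      rw [← colAct_compress]
      simp only [B, AddSubmonoidClass.coe_finsetSum, SetLike.val_smul]
    calc _ = ∑ l, ‖colAct b.conjTranspose
          (fun i => ∑ j, (A i j : K →L[ℂ] K) (colAct a x j)) l‖ ^ 2 := by rw [← h1]
      _ ≤ ∑ i, ‖∑ j, (A i j : K →L[ℂ] K) (colAct a x j)‖ ^ 2 := sum_norm_sq_colAct_le (hstar hb) _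
      _ ≤ (N : ℝ) ^ 2 * ∑ j, ‖colAct a x j‖ ^ 2 := matNorm_le_coe_iff.1 hN.le _
      _ ≤ _ := by gcongr; exact sum_norm_sq_colAct_le ha _
  have hBu : matNorm (B.map u) ≤ (c * N : ℝ≥0) := by
    rw [ENNReal.coe_mul]
    refine (matNorm_map_le_ampNorm u B).trans ?_
    rw [← hc]
    gcongr
  set ξ' := colAct a.conjTranspose ξ with hξ'
  have h2 : colAct b.conjTranspose η
      = fun l => ∑ k, ((B.map u) l k : EuclideanSpace ℂ (Fin m) →L[ℂ] _) (ξ' k) := by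
    ext l : 1
    have : ∀ j, ξ j = colAct a ξ' j := fun j => by rw [hξ', ← colAct_mul, haξ]
    simp only [hη, this]
    rw [← colAct_compress]
    have hB' : ∀ k, (B.map u) l k = ∑ i, ∑ j, (b.conjTranspose l i * a j k) • (A.map u) i j := by
      intro k
      rw [Matrix.map_apply]
      simp only [B, map_sum, map_smul]
      rfl
    simp only [hB', AddSubmonoidClass.coe_finsetSum, SetLike.val_smul]
  calc ∑ i, ‖η i‖ ^ 2 = ∑ i, ‖colAct b (colAct b.conjTranspose η) i‖ ^ 2 := by
        rw [← colAct_mul, hbη]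
    _ ≤ ∑ l, ‖colAct b.conjTranspose η l‖ ^ 2 := sum_norm_sq_colAct_le hb _
    _ ≤ ((c * N : ℝ≥0) : ℝ) ^ 2 * ∑ k, ‖ξ' k‖ ^ 2 := by
        rw [h2]
        exact matNorm_le_coe_iff.1 hBu ξ'
    _ ≤ _ := by gcongr; exact sum_norm_sq_colAct_le (hstar ha) ξ

end Smith

/-! ### Coordinates of the c₀-sum -/

section C0Sum

variable {H : ℕ → Type*} [∀ j, NormedAddCommGroup (H j)]

lemma summable_norm_sq (x : lp H 2) : Summable fun k => ‖x k‖ ^ 2 := by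
  have := (lp.memℓp x).summable (by norm_num)
  simpa using this

lemma norm_sq_eq_tsum (x : lp H 2) : ‖x‖ ^ 2 = ∑' k, ‖x k‖ ^ 2 := by
  have := lp.norm_rpow_eq_tsum (p := 2) (by norm_num) x
  simpa using this

variable [∀ j, InnerProductSpace ℂ (H j)]

/-- A bounded sequence of operators acts diagonally on the Hilbert space direct sum. -/
lemma exists_diagonal {z : ∀ j, H j →L[ℂ] H j} {c : ℝ} (hz : ∀ j, ‖z j‖ ≤ c) :
    ∃ S : lp H 2 →L[ℂ] lp H 2, ∀ x j, S x j = z j (x j) := by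
  have hc : 0 ≤ c := (norm_nonneg _).trans (hz 0)
  have hle : ∀ (x : lp H 2) j, ‖z j (x j)‖ ^ 2 ≤ c ^ 2 * ‖x j‖ ^ 2 := fun x j => by
    rw [← mul_pow]
    gcongr
    exact (z j).le_of_opNorm_le (hz j) _
  have hsum : ∀ x : lp H 2, Summable fun j => ‖z j (x j)‖ ^ 2 := fun x =>
    Summable.of_nonneg_of_le (fun j => by positivity) (hle x) ((summable_norm_sq x).mul_left _)
  have hmem : ∀ x : lp H 2, Memℓp (fun j => z j (x j)) 2 := fun x => by
    refine memℓp_gen ?_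
    simpa using hsum x
  let S : lp H 2 →ₗ[ℂ] lp H 2 :=
    { toFun := fun x => ⟨fun j => z j (x j), hmem x⟩
      map_add' := fun x y => by
        ext j
        exact map_add (z j) _ _
      map_smul' := fun a x => by
        ext j
        exact map_smul (z j) _ _ }
  have hS : ∀ x j, S x j = z j (x j) := fun _ _ => rfl
  refine ⟨S.mkContinuous c fun x => ?_, fun x j => rfl⟩
  rw [← sq_le_sq₀ (norm_nonneg _) (by positivity), mul_pow, norm_sq_eq_tsum, norm_sq_eq_tsum,
    ← tsum_mul_left]
  exact Summable.tsum_le_tsum (hle x) (hsum x) ((summable_norm_sq x).mul_left _)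

variable (Z : ∀ j, Submodule ℂ (H j →L[ℂ] H j))

/-- The `j`-th coordinate map on the `c₀`-sum. -/
noncomputable def c0Proj (j : ℕ) : c0Sum Z →ₗ[ℂ] Z j where
  -- Compression to the j-th summand recovers the block without choosing a sequence z, which makes
  -- linearity immediate.
  toFun S := ⟨(lp.evalCLM ℂ H 2 j) ∘L (S : lp H 2 →L[ℂ] lp H 2) ∘L
    (lp.singleContinuousLinearMap ℂ H 2 j), by
      obtain ⟨z, hz, -, hS⟩ := S.2
      convert hz j
      ext h
      simp [hS, lp.evalCLM]⟩
  map_add' S S' := by ext h; simp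
  map_smul' a S := by ext h; simp

variable {Z}

lemma c0Proj_eq {S : c0Sum Z} {z : ∀ j, H j →L[ℂ] H j}
    (hS : ∀ (x : lp H 2) (j : ℕ), (S : lp H 2 →L[ℂ] lp H 2) x j = z j (x j)) (j : ℕ) :
    (c0Proj Z j S : H j →L[ℂ] H j) = z j := by
  ext h
  simp [c0Proj, hS, lp.evalCLM]

lemma c0Sum_apply (S : c0Sum Z) (x : lp H 2) (j : ℕ) :
    (S : lp H 2 →L[ℂ] lp H 2) x j = (c0Proj Z j S : H j →L[ℂ] H j) (x j) := by
  obtain ⟨z, hz, -, hS⟩ := S.2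
  rw [c0Proj_eq hS, hS]

lemma tendsto_norm_c0Proj (S : c0Sum Z) : Tendsto (fun j => ‖c0Proj Z j S‖) atTop (𝓝 0) := by
  obtain ⟨z, hz, hz0, hS⟩ := S.2
  refine hz0.congr fun j => ?_
  rw [← c0Proj_eq hS j]
  rfl

lemma c0Sum_ext {S S' : c0Sum Z} (h : ∀ j, c0Proj Z j S = c0Proj Z j S') : S = S' := by
  ext x j
  rw [c0Sum_apply, c0Sum_apply, h]

lemma exists_c0Sum {z : ∀ j, Z j} (hz : Tendsto (fun j => ‖z j‖) atTop (𝓝 0)) :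
    ∃ S : c0Sum Z, ∀ j, c0Proj Z j S = z j := by
  obtain ⟨c, hc⟩ := hz.bddAbove_range
  obtain ⟨S, hS⟩ := exists_diagonal (z := fun j => (z j : H j →L[ℂ] H j)) (c := c)
    fun j => hc ⟨j, rfl⟩
  exact ⟨⟨S, fun j => z j, fun j => (z j).2, hz, hS⟩, fun j =>
    Subtype.ext (c0Proj_eq (z := fun j => (z j : H j →L[ℂ] H j)) hS j)⟩

lemma cbNorm_c0Proj_le (j : ℕ) : cbNorm (c0Proj Z j) ≤ 1 := by
  refine cbNorm_le fun n A => ?_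
  obtain ⟨N, hN⟩ : ∃ N : ℝ≥0, matNorm A = N := ⟨_, (ENNReal.coe_toNNReal (matNorm_ne_top A)).symm⟩
  rw [one_mul, hN, matNorm_le_coe_iff]
  intro x
  have h := matNorm_le_coe_iff.1 hN.le fun k => lp.single 2 j (x k)
  have h1 : ∀ k, ‖lp.single (E := H) 2 j (x k)‖ = ‖x k‖ := fun k =>
    lp.norm_single (by norm_num) j (x k)
  simp only [h1] at h
  refine le_trans (Finset.sum_le_sum fun i _ => ?_) h
  gcongr
  refine le_trans (le_of_eq ?_) (lp.norm_apply_le_norm (by norm_num) _ j)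
  congr 1
  rw [lp.coeFn_sum, Finset.sum_apply]
  refine Finset.sum_congr rfl fun k _ => ?_
  rw [c0Sum_apply, lp.single_apply_self]
  rfl

variable {K : Type*} [NormedAddCommGroup K] [InnerProductSpace ℂ K]
  {Y : Submodule ℂ (K →L[ℂ] K)}

/-- A matrix of block diagonal operators acts separately on each summand H k, so its squared norm
inequality is the sum over k of the coordinate inequalities. -/
lemma cbNorm_le_of_c0Proj {R : Y →ₗ[ℂ] c0Sum Z} {c : ℝ≥0}
    (h : ∀ j, cbNorm (c0Proj Z j ∘ₗ R) ≤ c) : cbNorm R ≤ c := by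
  refine cbNorm_le fun n A => ?_
  obtain ⟨N, hN⟩ : ∃ N : ℝ≥0, matNorm A = N := ⟨_, (ENNReal.coe_toNNReal (matNorm_ne_top A)).symm⟩
  rw [hN, ← ENNReal.coe_mul, matNorm_le_coe_iff]
  intro x
  have hj : ∀ j, matNorm (A.map (c0Proj Z j ∘ₗ R)) ≤ (c * N : ℝ≥0) := fun j => by
    rw [ENNReal.coe_mul, ← hN]
    exact (matNorm_map_le_cbNorm _ _).trans (by gcongr; exact h j)
  have hcoord : ∀ i k, (∑ j, ((A.map R) i j : lp H 2 →L[ℂ] lp H 2) (x j)) k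
      = ∑ j, ((A.map (c0Proj Z k ∘ₗ R)) i j : H k →L[ℂ] H k) (x j k) := fun i k => by
    rw [lp.coeFn_sum, Finset.sum_apply]
    exact Finset.sum_congr rfl fun j _ => c0Sum_apply _ _ _
  simp only [norm_sq_eq_tsum]
  rw [← Summable.tsum_finsetSum fun i _ => summable_norm_sq _,
    ← Summable.tsum_finsetSum fun i _ => summable_norm_sq _, ← tsum_mul_left]
  refine Summable.tsum_le_tsum (fun k => ?_) (summable_sum fun i _ => summable_norm_sq _)
    ((summable_sum fun i _ => summable_norm_sq _).mul_left _)
  simp only [hcoord]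
  exact matNorm_le_coe_iff.1 (hj k) fun j => x j k

/-- A uniformly completely bounded, pointwise null sequence of maps into the `Zⱼ` is the sequence
of coordinates of a completely bounded map into the `c₀`-sum. -/
lemma exists_toC0Sum {R : ∀ j, Y →ₗ[ℂ] Z j} {c : ℝ≥0} (hR : ∀ j, cbNorm (R j) ≤ c)
    (hR0 : ∀ y, Tendsto (fun j => ‖R j y‖) atTop (𝓝 0)) :
    ∃ S : Y →ₗ[ℂ] c0Sum Z, (∀ y j, c0Proj Z j (S y) = R j y) ∧ cbNorm S ≤ c := by
  choose f hf using fun y => exists_c0Sum (hR0 y)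
  let S : Y →ₗ[ℂ] c0Sum Z :=
    { toFun := f
      map_add' := fun y y' => c0Sum_ext fun j => by simp [hf]
      map_smul' := fun a y => c0Sum_ext fun j => by simp [hf] }
  refine ⟨S, hf, cbNorm_le_of_c0Proj fun j => ?_⟩
  have : c0Proj Z j ∘ₗ S = R j := LinearMap.ext fun y => hf y j
  rw [this]
  exact hR j

end C0Sum

/-! ### Finite rank maps and a single amplification -/

/-- A closed subspace `X` of finite codimension in `V` is the kernel of a bounded finite rank
projection of `V`. -/
lemma exists_finiteRank_projection {E : Type*} [NormedAddCommGroup E] [NormedSpace ℂ E]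
    {X S : Submodule ℂ E} (hX : IsClosed (X : Set E)) [FiniteDimensional ℂ S] :
    ∃ P : (S ⊔ X : Submodule ℂ E) →ₗ[ℂ] (S ⊔ X : Submodule ℂ E),
      FiniteDimensional ℂ (LinearMap.range P) ∧ (∃ p : ℝ, ∀ x, ‖P x‖ ≤ p * ‖x‖) ∧
      (∀ x : (S ⊔ X : Submodule ℂ E), (x : E) ∈ X → P x = 0) ∧
      ∀ x : (S ⊔ X : Submodule ℂ E), ((x - P x : (S ⊔ X : Submodule ℂ E)) : E) ∈ X := by
  set XV : Submodule ℂ (S ⊔ X : Submodule ℂ E) := X.comap (S ⊔ X).subtype with hXV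
  have hclosed : IsClosed (XV : Set (S ⊔ X : Submodule ℂ E)) := hX.preimage continuous_subtype_val
  -- The quotient is isomorphic to S/(S ∩ X). Hence X has a bounded projection f in S + X, and P =
  -- id - f.
  have : FiniteDimensional ℂ ((S ⊔ X : Submodule ℂ E) ⧸ XV) :=
    (LinearMap.quotientInfEquivSupQuotient S X).finiteDimensional
  obtain ⟨f, hf⟩ := Submodule.ClosedComplemented.of_finiteDimensional_quotient hclosed
  let P : (S ⊔ X : Submodule ℂ E) →L[ℂ] (S ⊔ X : Submodule ℂ E) :=
    ContinuousLinearMap.id ℂ _ - XV.subtypeL ∘L f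
  have hP : ∀ x, P x = x - f x := fun x => rfl
  have hP0 : ∀ x : (S ⊔ X : Submodule ℂ E), (x : E) ∈ X → P x = 0 := fun x hx => by
    rw [hP, hf ⟨x, hx⟩, sub_self]
  refine ⟨P, ?_, ⟨‖P‖, P.le_opNorm⟩, hP0, fun x => ?_⟩
  · have hker : XV ≤ LinearMap.ker (P : (S ⊔ X : Submodule ℂ E) →ₗ[ℂ] (S ⊔ X : Submodule ℂ E)) :=
      fun x hx => hP0 x hx
    rw [← Submodule.range_liftQ XV _ hker]
    infer_instance
  · have h : x - P x = f x := by rw [hP, sub_sub_cancel]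
    exact h ▸ (f x).2

/-- A bounded set of matrices has relatively compact image under a bounded finite rank operator. -/
lemma exists_finite_net {E : Type*} [NormedAddCommGroup E] [NormedSpace ℂ E]
    {V : Submodule ℂ E} (P : V →ₗ[ℂ] V) [FiniteDimensional ℂ (LinearMap.range P)] {p : ℝ}
    (hp : ∀ x, ‖P x‖ ≤ p * ‖x‖) {n : ℕ} {s : Set (Fin n → Fin n → V)}
    (hs : ∀ A ∈ s, ∀ i k, ‖A i k‖ ≤ 1) {η : ℝ} (hη : 0 < η) :
    ∃ t ⊆ s, t.Finite ∧ ∀ A ∈ s, ∃ B ∈ t, ∀ i k, ‖P (A i k - B i k)‖ ≤ η := by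
  let f : (Fin n → Fin n → V) → Fin n → Fin n → LinearMap.range P :=
    fun A i k => ⟨P (A i k), LinearMap.mem_range_self _ _⟩
  have htb : TotallyBounded (f '' s) := by
    refine (isCompact_closedBall
      (0 : Fin n → Fin n → LinearMap.range P) |p|).totallyBounded.subset ?_
    rintro _ ⟨A, hA, rfl⟩
    rw [mem_closedBall_zero_iff, pi_norm_le_iff_of_nonneg (abs_nonneg _)]
    intro i
    rw [pi_norm_le_iff_of_nonneg (abs_nonneg _)]
    intro k
    calc ‖P (A i k)‖ ≤ p * ‖A i k‖ := hp _
      _ ≤ |p| * 1 := mul_le_mul (le_abs_self p) (hs A hA i k) (norm_nonneg _) (abs_nonneg _)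
      _ = |p| := mul_one _
  obtain ⟨u, hus, huf, hsu⟩ := Metric.finite_approx_of_totallyBounded htb η hη
  -- The net is pulled back to elements of s itself, so that its members keep the norm bound
  -- defining s.
  choose! g hgs hfg using fun b (hb : b ∈ u) => hus hb
  refine ⟨g '' u, Set.image_subset_iff.2 hgs, huf.image g, fun A hA => ?_⟩
  obtain ⟨b, hb, hAb⟩ := Set.mem_iUnion₂.1 (hsu ⟨A, hA, rfl⟩)
  refine ⟨g b, ⟨b, hb, rfl⟩, fun i k => ?_⟩
  set B := g b
  have hdist : dist (f A) (f B) < η := by rw [hfg b hb]; exact hAb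
  have h := (dist_le_pi_dist (f A i) (f B i) k).trans
    ((dist_le_pi_dist (f A) (f B) i).trans hdist.le)
  rw [Subtype.dist_eq, dist_eq_norm, ← map_sub] at h
  exact h

section Step

variable {K : Type*} [NormedAddCommGroup K] [InnerProductSpace ℂ K]
  {H : ℕ → Type*} [∀ j, NormedAddCommGroup (H j)] [∀ j, InnerProductSpace ℂ (H j)]
  {Z : ∀ j, Submodule ℂ (H j →L[ℂ] H j)} {V : Submodule ℂ (K →L[ℂ] K)}

/-- The image under P of the unit ball of M_n(V) is totally bounded, so finitely many B in that ball
suffice. In T_j P M = T_j P(M - B) + T_j B - T_j(B - P B) the first term is small by the choice of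
B, the second is at most c, and the third involves finitely many entries on which the T_j tend to 0.
-/
lemma eventually_ampNorm_comp_le {P : V →ₗ[ℂ] V} [FiniteDimensional ℂ (LinearMap.range P)]
    (hP : ∃ p : ℝ, ∀ x, ‖P x‖ ≤ p * ‖x‖)
    {T : ∀ j, V →ₗ[ℂ] Z j} {c : ℝ≥0} (hT : ∀ j, cbNorm (T j) ≤ c)
    (hT0 : ∀ x, Tendsto (fun j => ‖T j (x - P x)‖) atTop (𝓝 0)) (n : ℕ) {δ : ℝ≥0} (hδ : 0 < δ) :
    ∀ᶠ j in atTop, ampNorm n (T j ∘ₗ P) ≤ (c + δ : ℝ≥0) := by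
  obtain ⟨p, hp⟩ := hP
  -- The two error terms add up to c·nη + nη; the extra 1 keeps the denominator positive.
  let η : ℝ≥0 := δ / (n * (c + 1) + 1)
  have hη : 0 < η := by positivity
  have hηδ : n * (c + 1) * η ≤ δ := by
    have : (n * (c + 1) + 1) * η = δ := mul_div_cancel₀ _ (by positivity)
    rw [← this]
    gcongr
    exact le_self_add
  obtain ⟨t, hts, htf, hst⟩ := exists_finite_net (E := K →L[ℂ] K) P hp
    (s := {A | matNorm (X := V) (n := n) A ≤ 1}) (fun A hA i k => by
      have := (enorm_entry_le_matNorm A i k).trans hA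
      rw [← ofReal_norm, ENNReal.ofReal_le_one] at this
      exact this) (η := η) hη
  have hev : ∀ᶠ j in atTop, ∀ B ∈ t, ∀ i k, ‖T j (B i k - P (B i k))‖ < η := by
    rw [htf.eventually_all]
    intro B _
    rw [eventually_all]
    intro i
    rw [eventually_all]
    intro k
    exact (hT0 _).eventually_lt_const hη
  filter_upwards [hev] with j hj
  refine iSup₂_le fun M hM => ?_
  obtain ⟨B, hBt, hMB⟩ := hst M hM
  let D : Matrix (Fin n) (Fin n) V := fun i k => P (M i k - B i k)
  let Q : Matrix (Fin n) (Fin n) (Z j) := fun i k => T j (B i k - P (B i k))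
  let B' : Matrix (Fin n) (Fin n) V := B
  have hsum : matNorm (M.map (T j ∘ₗ P)) =
      matNorm ((D.map (T j) + B'.map (T j) : Matrix (Fin n) (Fin n) (Z j)) + -Q) := by
    refine matNorm_congr fun i k => congrArg Subtype.val ?_
    change T j (P (M i k)) = T j (P (M i k - B i k)) + T j (B i k) + -T j (B i k - P (B i k))
    simp only [map_sub]
    abel
  have hD : matNorm D ≤ (n * η : ℝ≥0) := matNorm_le_of_entry_le hMB
  have hQ : matNorm Q ≤ (n * η : ℝ≥0) := matNorm_le_of_entry_le fun i k => (hj B hBt i k).le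
  rw [hsum]
  calc _ ≤ matNorm (D.map (T j)) + matNorm (B'.map (T j)) + matNorm Q := by
        refine (matNorm_add_le _ _).trans ?_
        rw [matNorm_neg]
        gcongr
        exact matNorm_add_le _ _
    _ ≤ (c : ℝ≥0∞) * (n * η : ℝ≥0) + c * 1 + (n * η : ℝ≥0) := by
        gcongr
        · exact (matNorm_map_le_cbNorm _ _).trans (mul_le_mul' (hT j) hD)
        · exact (matNorm_map_le_cbNorm _ _).trans (mul_le_mul' (hT j) (hts hBt))
    _ = ((c + n * (c + 1) * η : ℝ≥0) : ℝ≥0∞) := by push_cast; ring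
    _ ≤ (c + δ : ℝ≥0) := by gcongr

/-- A map whose range is close to a subspace of a matrix algebra has its cb-norm controlled by a
single amplification. -/
lemma cbNorm_le_mul_ampNorm {L : Type*} [NormedAddCommGroup L] [InnerProductSpace ℂ L]
    {W : Submodule ℂ (L →L[ℂ] L)} (w : V →ₗ[ℂ] W) {m n : ℕ} (hmn : m ≤ n)
    {G : Submodule ℂ (EuclideanSpace ℂ (Fin m) →L[ℂ] EuclideanSpace ℂ (Fin m))} {C : ℝ≥0∞}
    (hG : cbDist ((LinearMap.range w).map W.subtype) G < C) :
    cbNorm w ≤ C * ampNorm n w := by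
  set F := (LinearMap.range w).map W.subtype with hF
  -- The strict inequality yields an actual isomorphism e of the range; Smith's lemma applies to e ∘
  -- w, and e⁻¹ brings the estimate back.
  obtain ⟨c, ⟨-, e, -, -, he⟩, hcC⟩ := sInf_lt_iff.1 hG
  let w' : V →ₗ[ℂ] F := (W.subtype ∘ₗ w).codRestrict F fun x =>
    Submodule.mem_map_of_mem (LinearMap.mem_range_self w x)
  have hw' : ∀ x, (w x : L →L[ℂ] L) = w' x := fun _ => rfl
  have hcomp : w' = e.symm.toLinearMap ∘ₗ (e.toLinearMap ∘ₗ w') := by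
    ext x : 1
    simp
  calc cbNorm w = cbNorm (e.symm.toLinearMap ∘ₗ (e.toLinearMap ∘ₗ w')) := by
        rw [← hcomp]
        exact cbNorm_congr hw'
    _ ≤ cbNorm e.symm.toLinearMap * ampNorm n (e.toLinearMap ∘ₗ w') :=
        (cbNorm_comp_le _ _).trans (by gcongr; exact cbNorm_le_ampNorm hmn _)
    _ ≤ cbNorm e.symm.toLinearMap * (cbNorm e.toLinearMap * ampNorm n w') := by
        gcongr
        exact ampNorm_comp_le _ _
    _ = cbNorm e.toLinearMap * cbNorm e.symm.toLinearMap * ampNorm n w := by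
        rw [ampNorm_congr hw']
        ring
    _ ≤ C * ampNorm n w := by
        gcongr
        exact he.trans hcC.le

end Step

/-! ### Correcting maps that vanish on X -/

/-- Maps `T j` on `Y` that are pointwise null on `X` are eventually approximated, on a given finite
set, by maps that vanish on `X`. -/
lemma eventually_exists_vanishing {C lam : ℝ≥0}
    {H : ℕ → Type u} [∀ j, NormedAddCommGroup (H j)] [∀ j, InnerProductSpace ℂ (H j)]
    {Z : ∀ j, Submodule ℂ (H j →L[ℂ] H j)}
    (hcsep : ∀ j, HasCSEP.{v, u} lam (Z j)) (hexact : UniformlyExact C Z)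
    {K : Type v} [NormedAddCommGroup K] [InnerProductSpace ℂ K] [CompleteSpace K]
    {X Y : Submodule ℂ (K →L[ℂ] K)} (hXY : X ≤ Y) (hX : IsClosed (X : Set (K →L[ℂ] K)))
    (hY : IsClosed (Y : Set (K →L[ℂ] K))) [TopologicalSpace.SeparableSpace Y]
    {T : ∀ j, Y →ₗ[ℂ] Z j} {c : ℝ≥0} (hT : ∀ j, cbNorm (T j) ≤ c)
    (hT0 : ∀ x : X, Tendsto (fun j => ‖T j (Submodule.inclusion hXY x)‖) atTop (𝓝 0))
    {s : Set Y} (hs : s.Finite) {C' δ η : ℝ≥0} (hC' : C < C') (hδ : 0 < δ) (hη : 0 < η) :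
    ∀ᶠ j in atTop, ∃ S : Y →ₗ[ℂ] Z j, (∀ x : X, S (Submodule.inclusion hXY x) = 0) ∧
      cbNorm S ≤ (lam * (C' * (c + δ)) : ℝ≥0) ∧ ∀ y ∈ s, ‖T j y - S y‖ ≤ η := by
  set E := Submodule.span ℂ (Subtype.val '' s) with hE
  have : FiniteDimensional ℂ E := FiniteDimensional.span_of_finite ℂ (hs.image _)
  set V := E ⊔ X with hV
  have hVY : V ≤ Y := sup_le (Submodule.span_le.2 (by rintro _ ⟨y, -, rfl⟩; exact y.2)) hXY
  have hVc : IsClosed (V : Set (K →L[ℂ] K)) := by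
    rw [hV, sup_comm]
    exact Submodule.isClosed_sup_finiteDimensional _ _ hX
  obtain ⟨P, hPfin, hPb, hP0, hPX⟩ := exists_finiteRank_projection (S := E) hX
  obtain ⟨-, N, hN⟩ := hexact
  -- The rank of T_j ∘ P may vary with j and N need not be monotone, so n dominates N at every
  -- dimension up to the rank of P.
  let n := (Finset.range (Module.finrank ℂ (LinearMap.range P) + 1)).sup N
  let TV : ∀ j, V →ₗ[ℂ] Z j := fun j => T j ∘ₗ Submodule.inclusion hVY
  have hTV : ∀ j, cbNorm (TV j) ≤ c := fun j => cbNorm_le fun n A => by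
    have h1 : A.map (TV j) = (A.map (Submodule.inclusion hVY)).map (T j) := rfl
    have h2 : matNorm (A.map (Submodule.inclusion hVY)) = matNorm A := matNorm_congr fun _ _ => rfl
    rw [h1, ← h2]
    exact (matNorm_map_le_cbNorm _ _).trans (by gcongr; exact hT j)
  have hTV0 : ∀ x, Tendsto (fun j => ‖TV j (x - P x)‖) atTop (𝓝 0) := fun x =>
    hT0 ⟨_, hPX x⟩
  have hsmall : ∀ᶠ j in atTop, ∀ y : s,
      ‖TV j (⟨y, le_sup_left (a := E) (Submodule.subset_span ⟨y, y.2, rfl⟩)⟩ -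
        P ⟨y, le_sup_left (a := E) (Submodule.subset_span ⟨y, y.2, rfl⟩)⟩)‖ < η := by
    have := hs.to_subtype
    rw [eventually_all]
    intro y
    exact (hTV0 _).eventually_lt_const hη
  filter_upwards [eventually_ampNorm_comp_le hPb hTV hTV0 n hδ, hsmall] with j hj hjs
  set w : V →ₗ[ℂ] Z j := TV j ∘ₗ P with hw
  have hwP : ∀ x, w x = TV j (P x) := fun _ => rfl
  have hw_range : LinearMap.range w = (LinearMap.range P).map (TV j) :=
    LinearMap.range_comp _ _
  have hwfin : FiniteDimensional ℂ (LinearMap.range w) := by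
    rw [hw_range]
    infer_instance
  set F := (LinearMap.range w).map (Z j).subtype with hF
  have hFrank : Module.finrank ℂ F ≤ Module.finrank ℂ (LinearMap.range P) := by
    refine (Submodule.finrank_map_le _ _).trans ?_
    rw [hw_range]
    exact Submodule.finrank_map_le _ _
  obtain ⟨G, hG⟩ := hN j _ F (Submodule.map_subtype_le _ _) inferInstance rfl
  have hNn : N (Module.finrank ℂ F) ≤ n :=
    Finset.le_sup (f := N) (Finset.mem_range.2 (Nat.lt_succ_of_le hFrank))
  have hwcb : cbNorm w ≤ (C' * (c + δ) : ℝ≥0) := by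
    rw [ENNReal.coe_mul]
    refine (cbNorm_le_mul_ampNorm w hNn (C := C') (hG.trans_lt (by exact_mod_cast hC'))).trans ?_
    gcongr
  obtain ⟨S, -, hS, hScb⟩ := hcsep j K V Y hVY hVc hY inferInstance w
    (hwcb.trans_lt ENNReal.coe_lt_top)
  refine ⟨S, fun x => ?_, ?_, fun y hy => ?_⟩
  · have h1 := hS ⟨x, le_sup_right (a := E) x.2⟩
    rw [hwP, hP0 _ x.2, map_zero] at h1
    exact h1
  · rw [ENNReal.coe_mul]
    exact hScb.trans (by gcongr)
  · have h1 := hS ⟨y, le_sup_left (a := E) (Submodule.subset_span ⟨y, hy, rfl⟩)⟩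
    have h2 := hjs ⟨y, hy⟩
    rw [map_sub, ← hwP, ← h1] at h2
    exact h2.le

/-- A sequence satisfying each of countably many conditions eventually satisfies more and more of
them. -/
lemma exists_diagonal_index {p : ℕ → ℕ → Prop} (hp : ∀ k, ∀ᶠ j in atTop, p k j) :
    ∃ κ : ℕ → ℕ, Tendsto κ atTop atTop ∧ ∀ j, p (κ j) j ∨ κ j = 0 := by
  classical
  -- κ j is the largest k ≤ j whose condition holds at j; the value 0 is also the default when there
  -- is none.
  refine ⟨fun j => Nat.findGreatest (fun k => p k j) j, ?_, fun j => ?_⟩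
  · refine tendsto_atTop.2 fun k => ?_
    filter_upwards [hp k, eventually_ge_atTop k] with j hj hkj
    exact Nat.le_findGreatest hkj hj
  · by_cases h : Nat.findGreatest (fun k => p k j) j = 0
    · exact Or.inr h
    · exact Or.inl (Nat.findGreatest_of_ne_zero (P := fun k => p k j) rfl h)

/-- A bounded sequence of linear maps that is null on a dense set is pointwise null. -/
lemma tendsto_norm_zero_of_dense {E : Type*} [NormedAddCommGroup E] [NormedSpace ℂ E]
    {F : ℕ → Type*} [∀ j, NormedAddCommGroup (F j)] [∀ j, NormedSpace ℂ (F j)]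
    {R : ∀ j, E →ₗ[ℂ] F j} {c : ℝ} (hR : ∀ j x, ‖R j x‖ ≤ c * ‖x‖) {s : Set E} (hs : Dense s)
    (h : ∀ x ∈ s, Tendsto (fun j => ‖R j x‖) atTop (𝓝 0)) (x : E) :
    Tendsto (fun j => ‖R j x‖) atTop (𝓝 0) := by
  rw [Metric.tendsto_nhds]
  intro ε hε
  have hd : 0 < ε / (2 * (|c| + 1)) := by positivity
  obtain ⟨y, hy, hxy⟩ := hs.exists_dist_lt x hd
  filter_upwards [(h y hy).eventually_lt_const (half_pos hε)] with j hj
  rw [dist_zero_right, norm_norm]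
  have h1 : ‖R j (x - y)‖ ≤ ε / 2 := calc
    ‖R j (x - y)‖ ≤ c * ‖x - y‖ := hR j _
    _ ≤ (|c| + 1) * (ε / (2 * (|c| + 1))) := by
      rw [dist_eq_norm] at hxy
      exact mul_le_mul ((le_abs_self c).trans (by linarith)) hxy.le (norm_nonneg _) (by positivity)
    _ = ε / 2 := by field_simp
  calc ‖R j x‖ = ‖R j (x - y) + R j y‖ := by rw [← map_add, sub_add_cancel]
    _ ≤ ‖R j (x - y)‖ + ‖R j y‖ := norm_add_le _ _
    _ < ε := by linarith

/-- This is the bound of `eventually_exists_vanishing` with C' = C + δ and c = λτ; it is continuous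
in δ, with value Cλ²τ at δ = 0. -/
lemma exists_perturbation (C lam τ : ℝ≥0) {ε : ℝ≥0} (hε : 0 < ε) :
    ∃ δ : ℝ≥0, 0 < δ ∧ lam * ((C + δ) * (lam * τ + δ)) ≤ C * lam ^ 2 * τ + ε := by
  have hcont : Continuous fun δ : ℝ≥0 => lam * ((C + δ) * (lam * τ + δ)) := by fun_prop
  have h0 : lam * ((C + 0) * (lam * τ + 0)) < C * lam ^ 2 * τ + ε := by
    have : lam * ((C + 0) * (lam * τ + 0)) = C * lam ^ 2 * τ := by ring
    rw [this]
    exact lt_add_of_pos_right _ hε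
  have hev : ∀ᶠ δ in 𝓝[>] (0 : ℝ≥0), lam * ((C + δ) * (lam * τ + δ)) < C * lam ^ 2 * τ + ε :=
    (hcont.continuousAt.eventually_lt_const h0).filter_mono nhdsWithin_le_nhds
  obtain ⟨δ, hδ, hδ0⟩ := (hev.and self_mem_nhdsWithin).exists
  exact ⟨δ, hδ0, hδ.le⟩

end OpSpace

/-! ### Assembling the extension -/

theorem corollary2p5 (C lam : ℝ≥0)
    (H : ℕ → Type u) [∀ j, NormedAddCommGroup (H j)] [∀ j, InnerProductSpace ℂ (H j)]
    [∀ j, CompleteSpace (H j)]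
    (Z : ∀ j, Submodule ℂ (H j →L[ℂ] H j))
    (hZ : ∀ j, IsClosed (Z j : Set (H j →L[ℂ] H j)))
    (hcsep : ∀ j, OpSpace.HasCSEP.{v, u} lam (Z j))
    (hexact : OpSpace.UniformlyExact C Z) :
    ∀ ε : ℝ≥0, 0 < ε →
      OpSpace.HasCSEP.{v, u} (C * lam ^ 2 + lam + ε) (OpSpace.c0Sum Z) := by
  open OpSpace in
  intro ε hε K _ _ _ X Y hXY hX hY hsep T hTcb
  obtain ⟨τ, hτ⟩ : ∃ τ : ℝ≥0, cbNorm T = τ := ⟨_, (ENNReal.coe_toNNReal hTcb.ne).symm⟩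
  -- The slack ετ has to be positive; if τ = 0 then T = 0 and the zero map extends it.
  rcases eq_or_ne τ 0 with rfl | hτ0
  · have hzero : cbNorm (0 : Y →ₗ[ℂ] c0Sum Z) ≤ 0 := cbNorm_le fun n A => by
      have : A.map (0 : Y →ₗ[ℂ] c0Sum Z) = 0 := by ext i j : 1; rfl
      rw [this, matNorm_zero, zero_mul]
    refine ⟨0, hzero.trans_lt ENNReal.zero_lt_top, fun x => ?_, hzero.trans zero_le⟩
    have h := enorm_le_cbNorm_mul T x
    rw [hτ, ENNReal.coe_zero, zero_mul, nonpos_iff_eq_zero, enorm_eq_zero] at h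
    rw [h, LinearMap.zero_apply]
  have hετ : 0 < ε * τ := mul_pos hε (pos_iff_ne_zero.2 hτ0)
  obtain ⟨δ, hδ, hδle⟩ := exists_perturbation C lam τ hετ
  have hTj : ∀ j, cbNorm (c0Proj Z j ∘ₗ T) ≤ τ := fun j => by
    rw [← hτ]
    exact (cbNorm_comp_le _ _).trans (mul_le_of_le_one_left' (cbNorm_c0Proj_le j))
  choose E _ hEext hEcb using fun j =>
    hcsep j K X Y hXY hX hY hsep (c0Proj Z j ∘ₗ T) ((hTj j).trans_lt ENNReal.coe_lt_top)
  have hE : ∀ j, cbNorm (E j) ≤ (lam * τ : ℝ≥0) := fun j => by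
    rw [ENNReal.coe_mul]
    exact (hEcb j).trans (by gcongr; exact hTj j)
  have hE0 : ∀ x : X, Tendsto (fun j => ‖E j (Submodule.inclusion hXY x)‖) atTop (𝓝 0) :=
    fun x => (tendsto_norm_c0Proj (T x)).congr fun j => by rw [hEext]; rfl
  set y : ℕ → Y := TopologicalSpace.denseSeq Y with hy
  -- Condition k asks for accuracy 1/(k+1) on the first k points of a dense sequence; each holds for
  -- all large j, and κ lets k grow with j.
  have hk : ∀ k : ℕ, ∀ᶠ j in atTop, ∃ S : Y →ₗ[ℂ] Z j,
      (∀ x : X, S (Submodule.inclusion hXY x) = 0) ∧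
      cbNorm S ≤ (C * lam ^ 2 * τ + ε * τ : ℝ≥0) ∧
      ∀ i < k, ‖E j (y i) - S (y i)‖ ≤ 1 / ((k : ℝ) + 1) := fun k => by
    filter_upwards [eventually_exists_vanishing hcsep hexact hXY hX hY hE hE0
      ((Set.finite_lt_nat k).image y) (lt_add_of_pos_right C hδ) hδ
      (η := 1 / ((k : ℝ≥0) + 1)) (by positivity)] with j ⟨S, hS0, hScb, hSy⟩
    refine ⟨S, hS0, hScb.trans (by exact_mod_cast hδle), fun i hi => ?_⟩
    simpa using hSy (y i) ⟨i, hi, rfl⟩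
  obtain ⟨κ, hκ, hκp⟩ := exists_diagonal_index hk
  have hS : ∀ j, ∃ S : Y →ₗ[ℂ] Z j, (∀ x : X, S (Submodule.inclusion hXY x) = 0) ∧
      cbNorm S ≤ (C * lam ^ 2 * τ + ε * τ : ℝ≥0) ∧
      ∀ i < κ j, ‖E j (y i) - S (y i)‖ ≤ 1 / ((κ j : ℝ) + 1) := fun j => by
    rcases hκp j with h | h
    · exact h
    -- For κ j = 0 no point is tested, so the zero map serves.
    · refine ⟨0, fun x => rfl, cbNorm_le fun n A => ?_, fun i hi => ?_⟩
      · have : A.map (0 : Y →ₗ[ℂ] Z j) = 0 := by ext i j : 1; rfl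
        rw [this, matNorm_zero]
        exact zero_le
      · omega
  choose S hSX hScb hSy using hS
  have hR : ∀ j, cbNorm (E j - S j) ≤ ((C * lam ^ 2 + lam + ε) * τ : ℝ≥0) := fun j =>
    (cbNorm_sub_le _ _).trans <| (add_le_add (hE j) (hScb j)).trans <| le_of_eq <| by
      rw [← ENNReal.coe_add]
      congr 1
      ring
  have hRnorm : ∀ j x, ‖(E j - S j) x‖ ≤ ((C * lam ^ 2 + lam + ε) * τ : ℝ≥0) * ‖x‖ := fun j x => by
    have h := (enorm_le_cbNorm_mul (E j - S j) x).trans (mul_le_mul_left (hR j) _)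
    rw [← ofReal_norm, ← ofReal_norm, ← ENNReal.ofReal_coe_nnreal,
      ← ENNReal.ofReal_mul (NNReal.coe_nonneg _)] at h
    exact (ENNReal.ofReal_le_ofReal_iff (by positivity)).1 h
  have hR0 : ∀ x, Tendsto (fun j => ‖(E j - S j) x‖) atTop (𝓝 0) :=
    tendsto_norm_zero_of_dense hRnorm (TopologicalSpace.denseRange_denseSeq Y) (by
      rintro _ ⟨i, rfl⟩
      refine squeeze_zero' (Eventually.of_forall fun j => norm_nonneg _) ?_
        (tendsto_one_div_add_atTop_nhds_zero_nat.comp hκ)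
      filter_upwards [hκ.eventually_gt_atTop i] with j hj
      exact hSy j i hj)
  obtain ⟨T', hT', hT'cb⟩ := exists_toC0Sum hR hR0
  refine ⟨T', hT'cb.trans_lt ENNReal.coe_lt_top, fun x => c0Sum_ext fun j => ?_, ?_⟩
  · rw [hT', LinearMap.sub_apply, hSX, sub_zero, hEext]
    rfl
  · rw [hτ, ← ENNReal.coe_mul]
    exact hT'cb
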